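/- Let $G$ be an infinite profinite group, with center $Z(G)$ and derived subgroup $G'$. Then the following four conditions are equivalent: (i) $G$ has precisely countably infinitely many closed subgroups. (ii) $G$ has fewer than $2^{\aleph_0}$ closed subgroups. (iii) $Z(G)$ is open in $G$, and there are a finite non-empty set of primes $\{p_1,\dots,p_n\}$ (with $p_i\neq p_j$ for $i\neq j$) and a finite abelian group $F$ such that $Z(G)$ is topologically isomorphic to $F\times\bigoplus_{i=1}^n\mathbb{Z}_{p_i}$. (iv) $G'$ is finite, and there are a finite non-empty set of primes $\{p_1,\dots,p_n\}$ (with $p_i\neq p_j$ for $i\neq j$) and a finite abelian group $F$ such that $G/G'$ is topologically isomorphic to $F\times\bigoplus_{i=1}^n\mathbb{Z}_{p_i}$. Here $\mathbb{Z}_p$ denotes the additive topological group of $p$-adic integers, and $F$ carries the discrete topology. The sets of primes and the groups $F$ in (iii) and (iv) are chosen independently. -/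

import Mathlib

/-- The topological group `A` is topologically isomorphic to `F × ⨁_{p ∈ s} ℤ_p`, where `F` is some
finite abelian group (with the discrete topology) and `s` is some finite non-empty set of primes
(so there is one copy of `ℤ_p` for each `p ∈ s`, and distinct factors have distinct primes).
The sum is finite, so it is the product, with the product topology. It is written additively and
turned into a multiplicative group by `Multiplicative`. -/
def IsFiniteTimesDistinctPadics (A : Type*) [Group A] [TopologicalSpace A] : Prop :=
  ∃ (s : Finset ℕ) (_ : ∀ p : s, Fact (Nat.Prime p)) (F : Type) (_ : AddCommGroup F) (_ : TopologicalSpace F),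
    s.Nonempty ∧ Finite F ∧ DiscreteTopology F ∧
      Nonempty (A ≃ₜ* Multiplicative (F × ((p : s) → ℤ_[(p : ℕ)])))

/-!
Call `P` the condition that `G` has an open central subgroup isomorphic to a product of `ℤ_[p]` over
a finite non-empty set `s` of primes (`HasOpenCentralPadicProd`). All four conditions are equivalent
to `P`.

*Few closed subgroups imply `P`.* For `x, y` in a profinite group, "`x` is not in the closed
subgroup generated by `y`" is an open condition. If every non-empty open subset of some open `U₀`
contained such a pair, a Cantor scheme would give continuum many closed procyclic subgroups. So
every open set contains a non-empty open `U` any two elements of which generate the same closed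
subgroup (`exists_isOpen_forall_mem_procyclic`), and this subgroup contains `U`, hence is open.
Applied to the cosets of one open procyclic subgroup, this makes the centre open. Applied inside the
centre, it gives an open central procyclic subgroup. By the choice of `U` only finitely many primes
are involved, so the subgroup is a quotient of some `∏ ℤ_[p]`. Closed subgroups of `∏ ℤ_[p]` are
products of ideals, and dropping the coordinates with non-zero kernel proves `P`.

*`P` implies countability.* A closed subgroup `H` meets the central copy `B` of `∏ ℤ_[p]` in a product
of ideals, and `H` is determined by these ideals and by its image modulo an open subgroup of `B`
that depends only on them (`HasOpenCentralPadicProd.countable_closedSubgroup`).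

*`P` and the structural conditions.* A compact abelian group with an open copy of `∏ ℤ_[p]` splits as
a finite group times `∏ ℤ_[p]` (`isFiniteTimesDistinctPadics_of_isOpen_range`); this applies to the
centre and, as the derived subgroup is finite by Schur's theorem, to the abelianization. Conversely,
if the derived subgroup is finite, then an open normal subgroup meeting it trivially is central, and
a multiple of the copy of `∏ ℤ_[p]` in the abelianization lifts to it.
-/

universe u

/-! ### Cantor schemes of clopen sets -/

/-- A Cantor scheme argument. If every non-empty clopen subset of `U₀` contains two non-empty clopen
subsets whose images under `f` are disjoint, then `f` takes at least continuum many values. -/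
theorem two_power_aleph0_le_mk_of_clopen_splitting {X S : Type u} [TopologicalSpace X]
    [CompactSpace X] (f : X → S) {U₀ : Set X} (hU₀ : IsClopen U₀) (hne : U₀.Nonempty)
    (h : ∀ U ⊆ U₀, IsClopen U → U.Nonempty → ∃ V ⊆ U, ∃ W ⊆ U, IsClopen V ∧ V.Nonempty ∧
      IsClopen W ∧ W.Nonempty ∧ Disjoint (f '' V) (f '' W)) :
    (2 : Cardinal.{u}) ^ Cardinal.aleph0 ≤ Cardinal.mk S := by
  let T := {U : Set X // U ⊆ U₀ ∧ IsClopen U ∧ U.Nonempty}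
  have h' : ∀ U : T, ∃ c : Bool → T, (∀ b, (c b).1 ⊆ U.1) ∧
      ∀ b b', b ≠ b' → Disjoint (f '' (c b).1) (f '' (c b').1) := by
    rintro ⟨U, hU, hc, hn⟩
    obtain ⟨V, hV, W, hW, hVc, hVn, hWc, hWn, hd⟩ := h U hU hc hn
    refine ⟨fun b => bif b then ⟨V, hV.trans hU, hVc, hVn⟩ else ⟨W, hW.trans hU, hWc, hWn⟩, ?_, ?_⟩
    · rintro (_ | _) <;> assumption
    · rintro (_ | _) (_ | _) hb
      · exact absurd rfl hb
      · exact hd.symm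
      · exact hd
      · exact absurd rfl hb
  choose c hc hd using h'
  let A : (ℕ → Bool) → ℕ → T := fun α n =>
    Nat.rec ⟨U₀, subset_rfl, hU₀, hne⟩ (fun i U => c U (α i)) n
  have hA : ∀ α n, A α (n + 1) = c (A α n) (α n) := fun _ _ => rfl
  have hAeq : ∀ α β n, (∀ i < n, α i = β i) → A α n = A β n := by
    intro α β n
    induction n with
    | zero => exact fun _ => rfl
    | succ n ih =>
      intro hi
      rw [hA, hA, ih fun i hin => hi i (by omega), hi n (by omega)]
  have hx : ∀ α, (⋂ n, (A α n).1).Nonempty := fun α =>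
    IsCompact.nonempty_iInter_of_sequence_nonempty_isCompact_isClosed _
      (fun n => by rw [hA]; exact hc _ _) (fun n => (A α n).2.2.2)
      (A α 0).2.2.1.1.isCompact (fun n => (A α n).2.2.1.1)
  choose x hx using hx
  have hinj : Function.Injective fun α => f (x α) := by
    intro α β hαβ
    by_contra hne
    have hex : ∃ n, α n ≠ β n := Function.ne_iff.1 hne
    classical
    have hn := Nat.find_spec hex
    have hlt : ∀ i < Nat.find hex, α i = β i := fun i hi => not_not.1 (Nat.find_min hex hi)
    have h1 := Set.mem_iInter.1 (hx α) (Nat.find hex + 1)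
    have h2 := Set.mem_iInter.1 (hx β) (Nat.find hex + 1)
    rw [hA, hAeq α β _ hlt] at h1
    rw [hA] at h2
    exact Set.disjoint_left.1 (hd (A β (Nat.find hex)) _ _ hn) (Set.mem_image_of_mem f h1)
      ⟨x β, h2, hαβ.symm⟩
  have := Cardinal.lift_mk_le_lift_mk_of_injective hinj
  simpa using this

/-! ### Closed subgroups of a profinite group -/

section Profinite

variable {G : Type u} [Group G] [TopologicalSpace G] [IsTopologicalGroup G]

/-- The closed subgroup topologically generated by an element. -/
def procyclic (y : G) : Subgroup G := (Subgroup.zpowers y).topologicalClosure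

theorem isClosed_procyclic (y : G) : IsClosed (procyclic y : Set G) :=
  Subgroup.isClosed_topologicalClosure _

theorem mem_procyclic (y : G) : y ∈ procyclic y :=
  Subgroup.le_topologicalClosure _ (Subgroup.mem_zpowers y)

theorem procyclic_le {y : G} {H : Subgroup G} (hH : IsClosed (H : Set G)) (hy : y ∈ H) :
    procyclic y ≤ H :=
  Subgroup.topologicalClosure_minimal _ (by simpa using hy) hH

theorem exists_openNormalSubgroup_le [CompactSpace G] [TotallyDisconnectedSpace G] {U : Set G}
    (hU : IsOpen U) {x : G} (hx : x ∈ U) :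
    ∃ N : Subgroup G, N.Normal ∧ IsOpen (N : Set G) ∧ ∀ n ∈ N, x * n ∈ U := by
  obtain ⟨N, hN⟩ := ProfiniteGrp.exist_openNormalSubgroup_sub_open_nhds_of_one
    (hU.preimage (continuous_const_mul x)) (by simpa using hx)
  exact ⟨N.toSubgroup, N.isNormal', N.isOpen', fun n hn => hN hn⟩

/-- The relation `x ∉ procyclic y` is open in `(x, y)`; this provides the Cantor schemes. Hence, in
a profinite group with few closed subgroups, some open set consists of mutual generators. -/
theorem exists_isOpen_forall_mem_procyclic [CompactSpace G] [TotallyDisconnectedSpace G]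
    (hG : Cardinal.mk (ClosedSubgroup G) < 2 ^ Cardinal.aleph0) {U₀ : Set G} (hU₀ : IsOpen U₀)
    (hne : U₀.Nonempty) :
    ∃ U ⊆ U₀, IsOpen U ∧ U.Nonempty ∧ ∀ x ∈ U, ∀ y ∈ U, x ∈ procyclic y := by
  by_contra! hcon
  have hclopen : ∀ (N : Subgroup G), IsOpen (N : Set G) → ∀ x : G,
      IsClopen {g : G | x⁻¹ * g ∈ N} := fun N hN x =>
    IsClopen.preimage ⟨N.isClosed_of_isOpen hN, hN⟩ (continuous_const_mul _)
  obtain ⟨x₀, hx₀⟩ := hne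
  obtain ⟨N₀, -, hN₀, hN₀U⟩ := exists_openNormalSubgroup_le hU₀ hx₀
  refine hG.not_ge (two_power_aleph0_le_mk_of_clopen_splitting
    (fun y : G => (⟨procyclic y, isClosed_procyclic y⟩ : ClosedSubgroup G))
    (hclopen N₀ hN₀ x₀) ⟨x₀, by simp⟩ ?_)
  intro U hUU₀ hUc hUn
  obtain ⟨x, hx, y, hy, hxy⟩ := hcon U (fun g hg => by simpa using hN₀U _ (hUU₀ hg)) hUc.2 hUn
  obtain ⟨N₁, -, hN₁, hN₁U⟩ := exists_openNormalSubgroup_le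
    (isClosed_procyclic y).isOpen_compl (x := x) hxy
  obtain ⟨N₂, -, hN₂, hN₂U⟩ := exists_openNormalSubgroup_le hUc.2 hx
  obtain ⟨N₃, -, hN₃, hN₃U⟩ := exists_openNormalSubgroup_le hUc.2 hy
  obtain ⟨N, hNn, hN, hNle⟩ := exists_openNormalSubgroup_le
    ((hN₁.inter hN₂).inter hN₃) (x := (1 : G)) ⟨⟨one_mem _, one_mem _⟩, one_mem _⟩
  simp only [one_mul] at hNle
  refine ⟨{g | x⁻¹ * g ∈ N}, fun g hg => by simpa using hN₂U _ (hNle _ hg).1.2,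
    {g | y⁻¹ * g ∈ N}, fun g hg => by simpa using hN₃U _ (hNle _ hg).2,
    hclopen N hN x, ⟨x, by simp⟩, hclopen N hN y, ⟨y, by simp⟩, ?_⟩
  rw [Set.disjoint_left]
  rintro _ ⟨x', hx', rfl⟩ ⟨y', hy', he⟩
  have hxy' : x' ∈ procyclic y' := by
    have : procyclic y' = procyclic x' := congrArg ClosedSubgroup.toSubgroup he
    exact this ▸ mem_procyclic x'
  have hsup : IsOpen ((procyclic y ⊔ N : Subgroup G) : Set G) :=
    Subgroup.isOpen_mono le_sup_right hN
  have hy'mem : y' ∈ procyclic y ⊔ N := by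
    have := mul_mem (Subgroup.mem_sup_left (T := N) (mem_procyclic y))
      (Subgroup.mem_sup_right (S := procyclic y) hy')
    simpa using this
  have hx'mem := procyclic_le (Subgroup.isClosed_of_isOpen _ hsup) hy'mem hxy'
  obtain ⟨z, hz, n, hn, hzn⟩ := Subgroup.mem_sup_of_normal_right.1 hx'mem
  -- `z` lies both in `procyclic y` and in the coset `x * N`
  refine hN₁U (x⁻¹ * z) (hNle _ ?_).1.1 (by simpa using hz)
  have : x⁻¹ * z = x⁻¹ * x' * n⁻¹ := by rw [← hzn]; group
  rw [this]
  exact mul_mem hx' (inv_mem hn)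

theorem infinite_closedSubgroup [CompactSpace G] [TotallyDisconnectedSpace G] [Infinite G] :
    Infinite (ClosedSubgroup G) := by
  by_contra hfin
  rw [not_infinite_iff_finite] at hfin
  -- the intersection of the finitely many open subgroups is open, and it is trivial
  have hopen : IsOpen (⋂ H : {H : ClosedSubgroup G // IsOpen (H.toSubgroup : Set G)},
      (H.1.toSubgroup : Set G)) := isOpen_iInter_of_finite fun H => H.2
  have hone : (⋂ H : {H : ClosedSubgroup G // IsOpen (H.toSubgroup : Set G)},
      (H.1.toSubgroup : Set G)) = {1} := by
    refine Set.Subset.antisymm (fun x hx => ?_)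
      (Set.singleton_subset_iff.2 (Set.mem_iInter.2 fun H => H.1.toSubgroup.one_mem))
    by_contra hx1
    obtain ⟨N, -, hN, hNx⟩ := exists_openNormalSubgroup_le
      (isOpen_compl_singleton (x := x)) (x := (1 : G)) (fun h => hx1 h.symm)
    have := Set.mem_iInter.1 hx ⟨⟨N, N.isClosed_of_isOpen hN⟩, hN⟩
    exact hNx x this (one_mul x)
  rw [hone] at hopen
  have := discreteTopology_of_isOpen_singleton_one hopen
  have : Finite G := finite_of_compact_of_discrete
  exact not_finite G

end Profinite

/-! ### Finite products of rings of `p`-adic integers -/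

open Multiplicative

/-- The product of the rings `ℤ_[p]` over a finite set `s` of primes. -/
abbrev PadicProd (s : Finset ℕ) [∀ p : s, Fact (Nat.Prime p)] : Type := (p : s) → ℤ_[(p : ℕ)]

/-- The product of the elements of a finite set of natural numbers. -/
def primeProd (s : Finset ℕ) : ℕ := ∏ p ∈ s, p

theorem primeProd_eq_mul {s : Finset ℕ} (p : s) : primeProd s = p * primeProd (s.erase p) :=
  (Finset.mul_prod_erase s (fun p => p) p.2).symm

/-- `m'` can be taken to be the part of `m` prime to `q`. -/
theorem Nat.exists_coprime_dvd_mul_pow {m : ℕ} (hm : m ≠ 0) (q : ℕ) :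
    ∃ m' j, m'.Coprime q ∧ m ∣ m' * q ^ j := by
  induction m using Nat.strong_induction_on with
  | _ m ih =>
    by_cases h : m.Coprime q
    · exact ⟨m, 0, h, by simp⟩
    · obtain ⟨p, hp, ⟨m₁, rfl⟩, hpq⟩ := Nat.Prime.not_coprime_iff_dvd.1 h
      have hm₁ : m₁ ≠ 0 := right_ne_zero_of_mul hm
      obtain ⟨m', j, hco, hdvd⟩ := ih m₁
        (lt_mul_of_one_lt_left (Nat.pos_of_ne_zero hm₁) hp.one_lt) hm₁
      refine ⟨m', j + 1, hco, ?_⟩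
      rw [pow_succ, ← mul_assoc, mul_comm p]
      exact mul_dvd_mul hdvd hpq

theorem PadicInt.isUnit_natCast_of_coprime {p : ℕ} [hp : Fact p.Prime] {m : ℕ}
    (h : m.Coprime p) : IsUnit (m : ℤ_[p]) := by
  rw [PadicInt.isUnit_iff]
  refine le_antisymm (PadicInt.norm_le_one _) (not_lt.1 fun hlt => ?_)
  have : (p : ℤ) ∣ (m : ℤ) := (PadicInt.norm_int_lt_one_iff_dvd (m : ℤ)).1 (by simpa using hlt)
  have h1 : p ∣ 1 := h ▸ Nat.dvd_gcd (Int.natCast_dvd_natCast.1 this) dvd_rfl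
  exact hp.out.one_lt.ne' (Nat.dvd_one.1 h1)

theorem PadicInt.isOpen_setOf_pow_dvd {p : ℕ} [hp : Fact p.Prime] (k : ℕ) :
    IsOpen {z : ℤ_[p] | (p : ℤ_[p]) ^ k ∣ z} := by
  have : {z : ℤ_[p] | (p : ℤ_[p]) ^ k ∣ z} = Metric.closedBall 0 ((p : ℝ) ^ (-(k : ℤ))) := by
    ext z
    rw [Set.mem_ofPred_eq, ← Ideal.mem_span_singleton, ← PadicInt.norm_le_pow_iff_mem_span_pow,
      mem_closedBall_zero_iff]
  rw [this]
  exact IsUltrametricDist.isOpen_closedBall _ (by have := hp.out.pos; positivity)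

theorem PadicInt.isOpen_ideal {p : ℕ} [hp : Fact p.Prime] {I : Ideal ℤ_[p]} (hI : I ≠ ⊥) :
    IsOpen (I : Set ℤ_[p]) := by
  obtain ⟨n, rfl⟩ := PadicInt.ideal_eq_span_pow_p hI
  convert PadicInt.isOpen_setOf_pow_dvd (p := p) n using 1
  ext z
  simp [Ideal.mem_span_singleton]

theorem PadicInt.countable_ideal {p : ℕ} [hp : Fact p.Prime] : Countable (Ideal ℤ_[p]) := by
  have : Function.Surjective fun o : Option ℕ =>
      (o.elim ⊥ fun n => Ideal.span {(p : ℤ_[p]) ^ n} : Ideal ℤ_[p]) := by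
    intro I
    by_cases hI : I = ⊥
    · exact ⟨none, hI.symm⟩
    · obtain ⟨n, rfl⟩ := PadicInt.ideal_eq_span_pow_p hI
      exact ⟨some n, rfl⟩
  exact this.countable

section PadicProd

variable {s : Finset ℕ} [hs : ∀ p : s, Fact (Nat.Prime p)]

theorem coprime_primeProd_erase (p : s) : (primeProd (s.erase p)).Coprime p := by
  refine Nat.Coprime.prod_left fun r hr => ?_
  rw [Finset.mem_erase] at hr
  exact (Nat.coprime_primes (hs ⟨r, hr.2⟩).out (hs p).out).2 hr.1

theorem primeProd_dvd_iff (p : s) (k : ℕ) (z : ℤ_[(p : ℕ)]) :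
    (primeProd s : ℤ_[(p : ℕ)]) ^ k ∣ z ↔ ((p : ℕ) : ℤ_[(p : ℕ)]) ^ k ∣ z := by
  rw [primeProd_eq_mul p, Nat.cast_mul, mul_pow]
  exact ((PadicInt.isUnit_natCast_of_coprime (coprime_primeProd_erase p)).pow k).mul_right_dvd

theorem primeProd_pow_dvd_iff (k : ℕ) (x : PadicProd s) :
    (primeProd s : PadicProd s) ^ k ∣ x ↔ ∀ p : s, ((p : ℕ) : ℤ_[(p : ℕ)]) ^ k ∣ x p := by
  rw [pi_dvd_iff]
  refine forall_congr' fun p => ?_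
  rw [← primeProd_dvd_iff p k]
  simp

theorem isOpen_setOf_primeProd_pow_dvd (k : ℕ) :
    IsOpen {x : PadicProd s | (primeProd s : PadicProd s) ^ k ∣ x} := by
  simp only [primeProd_pow_dvd_iff, Set.ofPred_forall]
  exact isOpen_iInter_of_finite fun p =>
    (PadicInt.isOpen_setOf_pow_dvd (p := (p : ℕ)) k).preimage
      (continuous_apply (A := fun p : s => ℤ_[(p : ℕ)]) p)

theorem primeProd_pow_dvd_intCast_iff (k : ℕ) (n : ℤ) :
    (primeProd s : PadicProd s) ^ k ∣ n ↔ (primeProd s : ℤ) ^ k ∣ n := by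
  rw [primeProd_pow_dvd_iff]
  constructor
  · intro h
    have : ((primeProd s : ℕ) : ℤ) ^ k = ∏ p ∈ s, (p : ℤ) ^ k := by
      rw [primeProd, Nat.cast_prod, Finset.prod_pow]
    rw [this]
    refine Finset.prod_dvd_of_coprime ?_ ?_
    · intro a ha b hb hab
      exact (Nat.isCoprime_iff_coprime.2
        ((Nat.coprime_primes (hs ⟨a, ha⟩).out (hs ⟨b, hb⟩).out).2 hab)).pow
    · intro p hp
      have := h ⟨p, hp⟩
      rw [Pi.intCast_apply] at this
      exact (PadicInt.pow_p_dvd_int_iff (p := p) (hp := hs ⟨p, hp⟩) k n).1 this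
  · intro h p
    have h1 : ((p : ℕ) : ℤ) ^ k ∣ n := by
      refine (pow_dvd_pow_of_dvd ?_ k).trans h
      exact_mod_cast Dvd.intro _ (primeProd_eq_mul p).symm
    rw [Pi.intCast_apply]
    exact (PadicInt.pow_p_dvd_int_iff k n).2 h1

theorem exists_forall_primeProd_pow_dvd_mem {U : Set (PadicProd s)} (hU : IsOpen U)
    {x : PadicProd s} (hx : x ∈ U) :
    ∃ k : ℕ, ∀ y, (primeProd s : PadicProd s) ^ k ∣ y - x → y ∈ U := by
  obtain ⟨ε, hε, hball⟩ := Metric.isOpen_iff.1 hU x hx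
  obtain ⟨k, hk⟩ := exists_pow_lt_of_lt_one hε (by norm_num : (2⁻¹ : ℝ) < 1)
  refine ⟨k, fun y hy => hball ?_⟩
  rw [mem_ball_iff_norm, pi_norm_lt_iff hε]
  intro p
  have h1 := (primeProd_pow_dvd_iff k _).1 hy p
  rw [← Ideal.mem_span_singleton, ← PadicInt.norm_le_pow_iff_mem_span_pow] at h1
  refine (h1.trans ?_).trans_lt hk
  rw [zpow_neg, zpow_natCast, inv_pow]
  have : (2 : ℝ) ≤ (p : ℕ) := by exact_mod_cast (hs p).out.two_le
  gcongr

theorem denseRange_intCast_padicProd : DenseRange (Int.cast : ℤ → PadicProd s) := by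
  intro x
  rw [mem_closure_iff]
  intro U hU hx
  obtain ⟨k, hk⟩ := exists_forall_primeProd_pow_dvd_mem hU hx
  have hcop : Pairwise (Function.onFun IsCoprime
      fun p : s => (Ideal.span {((p : ℕ) : ℤ) ^ k} : Ideal ℤ)) := by
    intro a b hab
    refine (Ideal.isCoprime_span_singleton_iff _ _).2 ((Nat.isCoprime_iff_coprime.2
      ((Nat.coprime_primes (hs a).out (hs b).out).2 fun h => hab (Subtype.ext h))).pow)
  obtain ⟨n, hn⟩ := Ideal.exists_forall_sub_mem_ideal hcop fun p => ((x p).appr k : ℤ)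
  refine ⟨n, hk _ ?_, n, rfl⟩
  rw [primeProd_pow_dvd_iff]
  intro p
  have h1 := (x p).appr_spec k
  rw [Ideal.mem_span_singleton] at h1
  have h2 := (PadicInt.pow_p_dvd_int_iff (p := p) k _).2 (Ideal.mem_span_singleton.1 (hn p))
  have h3 := dvd_sub h2 h1
  rw [Pi.sub_apply, Pi.intCast_apply]
  convert h3 using 1
  push_cast
  ring

theorem mul_mem_of_isClosed {L : AddSubgroup (PadicProd s)} (hL : IsClosed (L : Set (PadicProd s)))
    (r : PadicProd s) {x : PadicProd s} (hx : x ∈ L) : r * x ∈ L := by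
  have hcl : IsClosed {r : PadicProd s | r * x ∈ L} :=
    hL.preimage (continuous_id.mul continuous_const)
  refine denseRange_intCast_padicProd.induction_on r hcl fun n => ?_
  rw [← zsmul_eq_mul]
  exact L.zsmul_mem hx n

/-- A closed subgroup of `∏ ℤ_[p]` is the product of ideals of the factors: it is stable under
multiplication by the dense subring `ℤ`, hence an ideal of the product ring. -/
theorem exists_ideals_of_isClosed {L : AddSubgroup (PadicProd s)}
    (hL : IsClosed (L : Set (PadicProd s))) :
    ∃ I : ∀ p : s, Ideal ℤ_[(p : ℕ)], ∀ x, x ∈ L ↔ ∀ p, x p ∈ I p := by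
  classical
  refine ⟨fun p =>
    { carrier := {z | Pi.single p z ∈ L}
      add_mem' := fun {a b} ha hb => by
        rw [Set.mem_ofPred_eq, Pi.single_add]
        exact L.add_mem ha hb
      zero_mem' := by simp
      smul_mem' := fun c z hz => by
        have := mul_mem_of_isClosed hL (Pi.single p c) hz
        rwa [← Pi.single_mul] at this }, fun x => ⟨fun hx p => ?_, fun hx => ?_⟩⟩
  · have := mul_mem_of_isClosed hL (Pi.single p 1) hx
    rw [← Pi.single_mul_left, one_mul] at this
    exact this
  · rw [← Finset.univ_sum_single x]
    exact L.sum_mem fun p _ => hx p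

theorem dense_zpowers_ofAdd_one :
    DenseRange fun n : ℤ => (ofAdd (1 : PadicProd s)) ^ n := by
  have h : (fun n : ℤ => (ofAdd (1 : PadicProd s)) ^ n) = fun n : ℤ => ofAdd (n : PadicProd s) := by
    ext1 n
    rw [← ofAdd_zsmul, zsmul_one]
  rw [h]
  exact denseRange_intCast_padicProd

/-- `1` is a topological generator of `∏ ℤ_[p]`. -/
theorem hom_eq_of_apply_one_eq {A : Type*} [Group A] [TopologicalSpace A] [T2Space A]
    {f g : Multiplicative (PadicProd s) →* A} (hf : Continuous f) (hg : Continuous g)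
    (h : f (ofAdd 1) = g (ofAdd 1)) : f = g := by
  refine DFunLike.coe_injective (dense_zpowers_ofAdd_one.equalizer hf hg ?_)
  ext n
  simp [h]

theorem hom_mem_of_apply_one_mem {A : Type*} [Group A] [TopologicalSpace A]
    {f : Multiplicative (PadicProd s) →* A} (hf : Continuous f) {H : Subgroup A}
    (hH : IsClosed (H : Set A)) (h : f (ofAdd 1) ∈ H) (x : Multiplicative (PadicProd s)) :
    f x ∈ H := by
  refine dense_zpowers_ofAdd_one.induction_on x (hH.preimage hf) fun n => ?_
  simpa using H.zpow_mem h n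

/-- The universal property of `∏ ℤ_[p]`: an element `a` of a profinite group whose order modulo
every open subgroup divides a power of the product of the primes in `s` is the image of `1` under a
continuous homomorphism. Its graph is the closed subgroup generated by `(1, a)`. -/
theorem exists_hom_apply_one_eq {G : Type*} [Group G] [TopologicalSpace G] [IsTopologicalGroup G]
    [CompactSpace G] [TotallyDisconnectedSpace G] (a : G)
    (ha : ∀ U : Subgroup G, IsOpen (U : Set G) → ∃ k : ℕ, a ^ primeProd s ^ k ∈ U) :
    ∃ φ : Multiplicative (PadicProd s) →* G, Continuous φ ∧ φ (ofAdd 1) = a := by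
  let Γ : Subgroup (Multiplicative (PadicProd s) × G) := procyclic (ofAdd 1, a)
  have : CompactSpace Γ := isCompact_iff_compactSpace.1 (isClosed_procyclic _).isCompact
  let π : Γ →* Multiplicative (PadicProd s) := (MonoidHom.fst _ _).comp Γ.subtype
  have hπ : Continuous π := continuous_fst.comp continuous_subtype_val
  have hinj : Function.Injective π := by
    rw [injective_iff_map_eq_one]
    rintro ⟨⟨c, x⟩, hx⟩ (hc : c = 1)
    subst hc
    suffices x = 1 by subst this; rfl
    by_contra hx1
    obtain ⟨U, hUn, hU, hUx⟩ := exists_openNormalSubgroup_le (isOpen_compl_singleton (x := x))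
      (x := (1 : G)) (fun h => hx1 h.symm)
    obtain ⟨k, hk⟩ := ha U hU
    have hO : IsOpen ({c : Multiplicative (PadicProd s) | (primeProd s : PadicProd s) ^ k ∣ toAdd c}
        ×ˢ {g : G | x⁻¹ * g ∈ U}) :=
      ((isOpen_setOf_primeProd_pow_dvd k).preimage continuous_toAdd).prod
        (hU.preimage (continuous_const_mul _))
    obtain ⟨⟨c, g⟩, ⟨hc, hg⟩, hcg⟩ := mem_closure_iff.1 hx _ hO ⟨by simp, by simp⟩
    obtain ⟨n, hn⟩ := Subgroup.mem_zpowers_iff.1 hcg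
    simp only [Prod.pow_mk, Prod.mk.injEq] at hn
    rw [Set.mem_ofPred_eq, ← hn.1, ← ofAdd_zsmul, zsmul_one, toAdd_ofAdd,
      primeProd_pow_dvd_intCast_iff] at hc
    obtain ⟨d, rfl⟩ := hc
    have hgU : g ∈ U := by
      rw [← hn.2, zpow_mul]
      exact U.zpow_mem (by exact_mod_cast hk) d
    have hxU : x ∈ U := by
      have := U.mul_mem hgU (U.inv_mem hg)
      simpa using this
    exact hUx x hxU (one_mul x)
  have hsurj : Function.Surjective π := by
    intro c
    have hcl : IsClosed (Set.range π) := (isCompact_range hπ).isClosed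
    refine dense_zpowers_ofAdd_one.induction_on c hcl fun n => ?_
    exact ⟨⟨(ofAdd 1, a), mem_procyclic _⟩ ^ n, by simp [π]⟩
  let e := MulEquiv.ofBijective π ⟨hinj, hsurj⟩
  have he : Continuous e.symm :=
    (Continuous.homeoOfEquivCompactToT2 (f := e.toEquiv) hπ).symm.continuous
  refine ⟨((MonoidHom.snd _ _).comp Γ.subtype).comp e.symm.toMonoidHom,
    (continuous_snd.comp continuous_subtype_val).comp he, ?_⟩
  have h1 : e.symm (ofAdd 1) = ⟨(ofAdd 1, a), mem_procyclic _⟩ := by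
    rw [MulEquiv.symm_apply_eq]
    rfl
  change (e.symm (ofAdd 1)).1.2 = a
  rw [h1]

end PadicProd

/-! ### Open subgroups of products of `p`-adic integers and their images -/

theorem MonoidHom.isOpenMap_of_isOpen_range {K G : Type*} [Group K] [TopologicalSpace K]
    [IsTopologicalGroup K] [CompactSpace K] [Group G] [TopologicalSpace G] [IsTopologicalGroup G]
    [T2Space G] {φ : K →* G} (hφ : Continuous φ) (ho : IsOpen (Set.range φ)) : IsOpenMap φ := by
  have : CompactSpace φ.range := isCompact_iff_compactSpace.1 (isCompact_range hφ)
  have h1 : IsOpenMap φ.rangeRestrict :=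
    φ.rangeRestrict.isOpenMap_of_sigmaCompact φ.rangeRestrict_surjective
      (hφ.subtype_mk _)
  have h2 : IsOpenMap (Subtype.val : φ.range → G) := IsOpen.isOpenMap_subtype_val ho
  exact h2.comp h1

/-- The product of the non-zero ideals among the `I p`, and of the full rings `ℤ_[p]` in the
remaining coordinates. It is an open subgroup of the product. -/
def nonzeroIdealProd {s : Finset ℕ} [∀ p : s, Fact (Nat.Prime p)]
    (I : ∀ p : s, Ideal ℤ_[(p : ℕ)]) : Subgroup (Multiplicative (PadicProd s)) where
  carrier := {x | ∀ p, I p ≠ ⊥ → toAdd x p ∈ I p}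
  mul_mem' hx hy p hp := (I p).add_mem (hx p hp) (hy p hp)
  one_mem' p _ := (I p).zero_mem
  inv_mem' hx p hp := (I p).neg_mem (hx p hp)

section

variable {s : Finset ℕ} [hs : ∀ p : s, Fact (Nat.Prime p)]

theorem isOpen_nonzeroIdealProd (I : ∀ p : s, Ideal ℤ_[(p : ℕ)]) :
    IsOpen (nonzeroIdealProd I : Set (Multiplicative (PadicProd s))) := by
  have : (nonzeroIdealProd I : Set (Multiplicative (PadicProd s))) =
      ⋂ p : s, {x : Multiplicative (PadicProd s) | I p ≠ ⊥ → toAdd x p ∈ I p} := by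
    ext x
    simp [nonzeroIdealProd]
  rw [this]
  refine isOpen_iInter_of_finite fun p => ?_
  by_cases hp : I p = ⊥
  · simp [hp]
  · have h := (PadicInt.isOpen_ideal hp).preimage
      ((continuous_apply (A := fun p : s => ℤ_[(p : ℕ)]) p).comp continuous_toAdd)
    convert h using 1
    ext x
    simp [hp]

theorem exists_ideals_comap {G : Type*} [Group G] [TopologicalSpace G]
    {φ : Multiplicative (PadicProd s) →* G} (hφ : Continuous φ) {H : Subgroup G}
    (hH : IsClosed (H : Set G)) :
    ∃ I : ∀ p : s, Ideal ℤ_[(p : ℕ)], ∀ x, φ x ∈ H ↔ ∀ p, toAdd x p ∈ I p := by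
  obtain ⟨I, hI⟩ := exists_ideals_of_isClosed (L := Subgroup.toAddSubgroup' (H.comap φ))
    ((hH.preimage hφ).preimage continuous_ofAdd)
  exact ⟨I, fun x => hI (toAdd x)⟩

end

/-- Extension by zero, as a map from the product over `t` to the product over `s`. Coordinates
outside `s` are dropped. -/
noncomputable def PadicProd.extendZero (t s : Finset ℕ) [∀ p : t, Fact (Nat.Prime p)]
    [∀ p : s, Fact (Nat.Prime p)] : PadicProd t →+ PadicProd s where
  toFun x p := if h : (p : ℕ) ∈ t then x ⟨p, h⟩ else 0
  map_zero' := by ext1 p; split_ifs <;> rfl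
  map_add' x y := by
    ext1 p
    simp only [Pi.add_apply]
    split_ifs <;> simp

section

variable {t s : Finset ℕ} [ht : ∀ p : t, Fact (Nat.Prime p)] [hs : ∀ p : s, Fact (Nat.Prime p)]

theorem PadicProd.extendZero_of_mem (x : PadicProd t) {p : ℕ} (hps : p ∈ s) (hpt : p ∈ t) :
    extendZero t s x ⟨p, hps⟩ = x ⟨p, hpt⟩ := dif_pos hpt

theorem PadicProd.extendZero_of_notMem (x : PadicProd t) {p : ℕ} (hps : p ∈ s) (hpt : p ∉ t) :
    extendZero t s x ⟨p, hps⟩ = 0 := dif_neg hpt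

theorem PadicProd.continuous_extendZero : Continuous (extendZero t s) := by
  refine continuous_pi fun p => ?_
  by_cases h : (p : ℕ) ∈ t
  · simpa only [extendZero_of_mem _ p.2 h] using
      continuous_apply (A := fun p : t => ℤ_[(p : ℕ)]) ⟨p, h⟩
  · simpa only [extendZero_of_notMem _ p.2 h] using continuous_const

/-- A homomorphism from `∏ ℤ_[p]` with open image becomes injective, with open image, once the
coordinates in which its kernel is non-trivial are discarded. -/
theorem exists_injective_of_isOpen_range {G : Type*} [Group G] [TopologicalSpace G]
    [IsTopologicalGroup G] [T2Space G] {φ : Multiplicative (PadicProd s) →* G} (hφ : Continuous φ)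
    (ho : IsOpen (Set.range φ)) :
    ∃ (t : Finset ℕ) (_ : ∀ p : t, Fact (Nat.Prime p)) (ψ : Multiplicative (PadicProd t) →* G),
      Continuous ψ ∧ Function.Injective ψ ∧ IsOpen (Set.range ψ) ∧ Set.range ψ ⊆ Set.range φ := by
  have hφo : IsOpenMap φ := MonoidHom.isOpenMap_of_isOpen_range hφ ho
  obtain ⟨I, hI⟩ := exists_ideals_comap hφ (H := ⊥) isClosed_singleton
  simp only [Subgroup.mem_bot] at hI
  classical
  let t : Finset ℕ := s.filter fun p => ∃ h : p ∈ s, I ⟨p, h⟩ = ⊥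
  have hts : ∀ p ∈ t, p ∈ s := fun p hp => (Finset.mem_filter.1 hp).1
  have htI : ∀ p (hp : p ∈ t), I ⟨p, hts p hp⟩ = ⊥ := fun p hp => (Finset.mem_filter.1 hp).2.2
  have htI' : ∀ p (hp : p ∈ s), p ∉ t → I ⟨p, hp⟩ ≠ ⊥ :=
    fun p hp hpt h => hpt (Finset.mem_filter.2 ⟨hp, hp, h⟩)
  clear_value t
  have ht : ∀ p : t, Fact (Nat.Prime p) := fun p => hs ⟨p, hts p p.2⟩
  let ψ : Multiplicative (PadicProd t) →* G :=
    φ.comp (AddMonoidHom.toMultiplicative (PadicProd.extendZero t s))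
  have hψ : Continuous ψ :=
    hφ.comp (continuous_ofAdd.comp (PadicProd.continuous_extendZero.comp continuous_toAdd))
  have hψx : ∀ x, ψ (ofAdd x) = φ (ofAdd (PadicProd.extendZero t s x)) := fun _ => rfl
  clear_value ψ
  refine ⟨t, ht, ψ, hψ, ?_, ?_, ?_⟩
  · rw [injective_iff_map_eq_one]
    intro x hx
    obtain ⟨x, rfl⟩ := ofAdd.surjective x
    rw [hψx, hI, toAdd_ofAdd] at hx
    rw [ofAdd_eq_one]
    funext p
    have h1 := hx ⟨p, hts p p.2⟩
    rwa [htI p p.2, PadicProd.extendZero_of_mem x _ p.2, Ideal.mem_bot] at h1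
  · refine Subgroup.isOpen_mono (H₁ := (nonzeroIdealProd I).map φ) (H₂ := ψ.range) ?_
      (hφo _ (isOpen_nonzeroIdealProd I))
    rintro _ ⟨x, hx, rfl⟩
    obtain ⟨x, rfl⟩ := ofAdd.surjective x
    refine ⟨ofAdd fun p => x ⟨p, hts p p.2⟩, ?_⟩
    rw [hψx, ← inv_mul_eq_one, ← map_inv, ← map_mul, hI]
    rintro ⟨p, hp⟩
    rw [toAdd_mul, toAdd_inv, toAdd_ofAdd, toAdd_ofAdd, Pi.add_apply, Pi.neg_apply]
    by_cases hpt : p ∈ t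
    · rw [PadicProd.extendZero_of_mem _ hp hpt, neg_add_cancel]
      exact zero_mem _
    · rw [PadicProd.extendZero_of_notMem _ hp hpt, neg_zero, zero_add]
      exact hx ⟨p, hp⟩ (htI' p hp hpt)
  · rintro _ ⟨x, rfl⟩
    obtain ⟨x, rfl⟩ := ofAdd.surjective x
    exact ⟨_, (hψx x).symm⟩

end

/-! ### Counting closed subgroups -/

/-- The group has an open central subgroup topologically isomorphic to the product of the `ℤ_[p]`
over a finite non-empty set of primes. The subgroup is given by its embedding. -/
def HasOpenCentralPadicProd (G : Type*) [Group G] [TopologicalSpace G] : Prop :=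
  ∃ (s : Finset ℕ) (_ : ∀ p : s, Fact (Nat.Prime p)) (φ : Multiplicative (PadicProd s) →* G),
    s.Nonempty ∧ Continuous φ ∧ Function.Injective φ ∧ IsOpen (Set.range φ) ∧
      ∀ x, φ x ∈ Subgroup.center G

/-- Let `B` be the central copy of `∏ ℤ_[p]`. A closed subgroup `H` is determined by the ideals
describing `H ∩ B`, for which there are countably many choices, together with the image of `H`
modulo an open subgroup of `B` that depends only on these ideals. -/
theorem HasOpenCentralPadicProd.countable_closedSubgroup {G : Type*} [Group G] [TopologicalSpace G]
    [IsTopologicalGroup G] [CompactSpace G] [T2Space G] (h : HasOpenCentralPadicProd G) :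
    Countable (ClosedSubgroup G) := by
  obtain ⟨s, hs, φ, -, hφ, hinj, ho, hc⟩ := h
  have hcomm : ∀ x g, Commute g (φ x) := fun x g => Subgroup.mem_center_iff.1 (hc x) g
  have hnormal : φ.range.Normal := by
    refine ⟨?_⟩
    rintro _ ⟨x, rfl⟩ g
    exact ⟨x, by rw [(hcomm x g).eq]; group⟩
  have hfin : Finite (G ⧸ φ.range) := Subgroup.quotient_finite_of_isOpen _ ho
  have hm : φ.range.index ≠ 0 := Subgroup.index_ne_zero_of_finite
  have hpow : ∀ g : G, ∃ x, φ x = g ^ φ.range.index := fun g => φ.range.pow_index_mem g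
  generalize φ.range.index = m at hm hpow
  choose I hI using fun H : ClosedSubgroup G => exists_ideals_comap hφ H.isClosed'
  let W : (∀ p : s, Ideal ℤ_[(p : ℕ)]) → Subgroup G := fun J => (nonzeroIdealProd J).map φ
  have hW : ∀ J, Finite (G ⧸ W J) := fun J => Subgroup.quotient_finite_of_isOpen _
    (MonoidHom.isOpenMap_of_isOpen_range hφ ho _ (isOpen_nonzeroIdealProd J))
  have hle : ∀ H H' : ClosedSubgroup G, I H = I H' →
      (∀ h' ∈ H'.toSubgroup, ∃ h ∈ H.toSubgroup, h⁻¹ * h' ∈ W (I H)) →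
      H'.toSubgroup ≤ H.toSubgroup := by
    intro H H' hII hWH h' hh'
    obtain ⟨h, hh, v, hv, hvh⟩ := hWH h' hh'
    obtain rfl : h' = h * φ v := by rw [hvh]; group
    obtain ⟨c, hcm⟩ := hpow (h * φ v)
    have h1 : (h * φ v) ^ m ∈ H.toSubgroup := by
      rw [← hcm, hI H, hII, ← hI H', hcm]
      exact pow_mem hh' m
    rw [(hcomm v h).mul_pow] at h1
    have h2 : φ (v ^ m) ∈ H.toSubgroup := by
      rw [map_pow]
      simpa using mul_mem (inv_mem (pow_mem hh m)) h1
    refine mul_mem hh ((hI H v).2 fun p => ?_)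
    by_cases hp : I H p = ⊥
    · -- here `ℤ_[p]` is torsion-free
      have h3 := (hI H _).1 h2 p
      rw [hp, Ideal.mem_bot] at h3 ⊢
      rw [toAdd_pow, Pi.smul_apply] at h3
      exact (smul_eq_zero.1 h3).resolve_left hm
    · exact hv p hp
  have : Countable (∀ p : s, Ideal ℤ_[(p : ℕ)]) := by
    have := fun p : s => PadicInt.countable_ideal (p := p)
    infer_instance
  let F : ClosedSubgroup G → Σ J, Set (G ⧸ W J) := fun H =>
    ⟨I H, QuotientGroup.mk '' (H.toSubgroup : Set G)⟩
  have hFle : ∀ H H' : ClosedSubgroup G, F H = F H' → H'.toSubgroup ≤ H.toSubgroup := by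
    intro H H' hFF
    refine hle H H' (congrArg Sigma.fst hFF) fun h' hh' => ?_
    have h1 : (QuotientGroup.mk h' : G ⧸ W (F H').1) ∈ (F H').2 := ⟨h', hh', rfl⟩
    rw [← hFF] at h1
    obtain ⟨h, hh, he⟩ := h1
    exact ⟨h, hh, QuotientGroup.eq.1 he⟩
  have hFinj : Function.Injective F := fun H H' hFF =>
    ClosedSubgroup.toSubgroup_injective ((hFle H' H hFF.symm).antisymm (hFle H H' hFF))
  exact hFinj.countable

/-! ### Groups with few closed subgroups -/

section

variable {G : Type u} [Group G] [TopologicalSpace G] [IsTopologicalGroup G]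

theorem pow_mem_procyclic_pow {y z : G} (hz : z ∈ procyclic y) (k : ℕ) :
    z ^ k ∈ procyclic (y ^ k) := by
  have hcl : IsClosed {z : G | z ^ k ∈ procyclic (y ^ k)} :=
    (isClosed_procyclic _).preimage (continuous_pow k)
  refine closure_minimal ?_ hcl hz
  intro g hg
  obtain ⟨n, rfl⟩ := Subgroup.mem_zpowers_iff.1 hg
  have : (y ^ n) ^ k = (y ^ k) ^ n := by
    rw [← zpow_natCast, ← zpow_natCast, zpow_comm]
  rw [Set.mem_ofPred_eq, this]
  exact zpow_mem (mem_procyclic _) n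

theorem commute_of_mem_procyclic [T2Space G] {y a b : G} (ha : a ∈ procyclic y)
    (hb : b ∈ procyclic y) : Commute a b := by
  have key : ∀ c z : G, Commute c y → z ∈ procyclic y → Commute c z := by
    intro c z hc hz
    have h1 := procyclic_le (H := Subgroup.centralizer {c}) (Set.isClosed_centralizer _)
      (Subgroup.mem_centralizer_singleton_iff.2 hc.eq.symm) hz
    exact (Subgroup.mem_centralizer_singleton_iff.1 h1).symm
  exact key a b (key y a rfl ha).symm hb

variable [CompactSpace G] [TotallyDisconnectedSpace G]

/-- In a profinite group with few closed subgroups, the centre is open: every coset of an open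
procyclic subgroup `C` contains some `y` with `procyclic y` open, and `procyclic y ⊓ C` commutes with
the whole coset. -/
theorem isOpen_center_of_mk_closedSubgroup_lt
    (hG : Cardinal.mk (ClosedSubgroup G) < 2 ^ Cardinal.aleph0) :
    IsOpen (Subgroup.center G : Set G) := by
  have hopen : ∀ U : Set G, IsOpen U → U.Nonempty → ∃ y ∈ U, IsOpen (procyclic y : Set G) := by
    intro U hU hUn
    obtain ⟨V, hVU, hV, ⟨y, hy⟩, hgen⟩ := exists_isOpen_forall_mem_procyclic hG hU hUn
    exact ⟨y, hVU hy, Subgroup.isOpen_of_mem_nhds _ (g := y)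
      (Filter.mem_of_superset (hV.mem_nhds hy) fun x hx => hgen x hx y hy)⟩
  obtain ⟨g, -, hg⟩ := hopen Set.univ isOpen_univ ⟨1, trivial⟩
  have hfin : Finite (G ⧸ procyclic g) := Subgroup.quotient_finite_of_isOpen _ hg
  have hcoset : ∀ x : G, ∃ c ∈ procyclic g, IsOpen (procyclic (x * c) : Set G) := by
    intro x
    obtain ⟨y, hy, hyo⟩ := hopen {y | x⁻¹ * y ∈ procyclic g}
      (hg.preimage (continuous_const_mul _)) ⟨x, by simp [one_mem]⟩
    exact ⟨x⁻¹ * y, hy, by simpa using hyo⟩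
  choose c hc hco using hcoset
  let D : Subgroup G := procyclic g ⊓ ⨅ q : G ⧸ procyclic g, procyclic (q.out * c q.out)
  have hD : IsOpen (D : Set G) := by
    simp only [D, Subgroup.coe_inf, Subgroup.coe_iInf]
    exact hg.inter (isOpen_iInter_of_finite fun q => hco _)
  refine Subgroup.isOpen_mono (fun z hz => ?_) hD
  rw [Subgroup.mem_center_iff]
  intro x
  obtain ⟨hzg, hzq⟩ := Subgroup.mem_inf.1 hz
  obtain ⟨⟨h, hh⟩, hx⟩ := QuotientGroup.mk_out_eq_mul (procyclic g) x
  set q : G ⧸ procyclic g := QuotientGroup.mk x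
  have hq := (Subgroup.mem_iInf.1 hzq) q
  have h1 : Commute (q.out * c q.out) z := commute_of_mem_procyclic (mem_procyclic _) hq
  have h2 : Commute (c q.out) z := commute_of_mem_procyclic (hc _) hzg
  have h3 : Commute h z := commute_of_mem_procyclic hh hzg
  have hxe : x = (q.out * c q.out) * (c q.out)⁻¹ * h⁻¹ := by
    rw [hx]; group
  rw [hxe]
  exact (h1.mul_left h2.inv_left).mul_left h3.inv_left

/-- A topological generator `y` of an open central procyclic subgroup can be chosen so that the
elements near `y` generate the same subgroup. Only finitely many primes can then be involved, so
`procyclic y` is a quotient of some `∏ ℤ_[p]`. -/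
theorem hasOpenCentralPadicProd_of_mk_closedSubgroup_lt [Infinite G]
    (hG : Cardinal.mk (ClosedSubgroup G) < 2 ^ Cardinal.aleph0) :
    HasOpenCentralPadicProd G := by
  obtain ⟨U, hUc, hU, ⟨y, hy⟩, hgen⟩ := exists_isOpen_forall_mem_procyclic hG
    (isOpen_center_of_mk_closedSubgroup_lt hG) ⟨1, one_mem _⟩
  have hyo : IsOpen (procyclic y : Set G) := Subgroup.isOpen_of_mem_nhds _ (g := y)
    (Filter.mem_of_superset (hU.mem_nhds hy) fun x hx => hgen x hx y hy)
  have hcen : ∀ z ∈ procyclic y, z ∈ Subgroup.center G :=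
    fun z hz => procyclic_le (Subgroup.isClosed_of_isOpen _
      (isOpen_center_of_mk_closedSubgroup_lt hG)) (hUc hy) hz
  obtain ⟨N, hNn, hN, hNU⟩ := exists_openNormalSubgroup_le hU hy
  have hNfin : Finite (G ⧸ N) := Subgroup.quotient_finite_of_isOpen _ hN
  have hn0 : N.index ≠ 0 := Subgroup.index_ne_zero_of_finite
  have hyn : y ^ N.index ∈ N := N.pow_index_mem y
  generalize N.index = n at hn0 hyn
  -- `y ^ m` generates `procyclic y` when `m` is prime to `n`: some power of it lies in `y * N`
  have hcop : ∀ m : ℕ, m.Coprime n → y ∈ procyclic (y ^ m) := by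
    intro m hm
    obtain ⟨a, b, hab⟩ := Nat.isCoprime_iff_coprime.2 hm
    have h1 : y * (y ^ n) ^ (-b) = (y ^ m) ^ a := by
      rw [← zpow_natCast, ← zpow_natCast, ← zpow_mul, ← zpow_mul, ← zpow_one_add]
      congr 1
      linarith
    have h2 := hNU _ (zpow_mem hyn (-b))
    rw [h1] at h2
    exact procyclic_le (isClosed_procyclic _) (zpow_mem (mem_procyclic _) a) (hgen y hy _ h2)
  let s := n.primeFactors
  have hs : ∀ p : s, Fact (Nat.Prime p) := fun p => ⟨Nat.prime_of_mem_primeFactors p.2⟩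
  have hord : ∀ O : Subgroup G, IsOpen (O : Set G) → ∃ k : ℕ, y ^ primeProd s ^ k ∈ O := by
    intro O hO
    obtain ⟨M, hMn, hM, hMO⟩ := exists_openNormalSubgroup_le hO (x := 1) (one_mem _)
    have hMfin : Finite (G ⧸ M) := Subgroup.quotient_finite_of_isOpen _ hM
    obtain ⟨m', j, hco, e, he⟩ := Nat.exists_coprime_dvd_mul_pow
      (Subgroup.index_ne_zero_of_finite (H := M)) (primeProd s)
    have hco' : m'.Coprime n := by
      by_contra hnot
      obtain ⟨p, hp, hpm, hpn⟩ := Nat.Prime.not_coprime_iff_dvd.1 hnot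
      refine Nat.Prime.not_coprime_iff_dvd.2 ⟨p, hp, hpm, ?_⟩ hco
      exact Finset.dvd_prod_of_mem (fun p => p) (Nat.mem_primeFactors.2 ⟨hp, hpn, hn0⟩)
    have h1 := pow_mem_procyclic_pow (hcop m' hco') (primeProd s ^ j)
    rw [← pow_mul, he, pow_mul] at h1
    refine ⟨j, procyclic_le (O.isClosed_of_isOpen hO) ?_ h1⟩
    simpa using hMO _ (pow_mem (M.pow_index_mem y) e)
  obtain ⟨φ, hφ, hφ1⟩ := exists_hom_apply_one_eq y hord
  have hrange : (procyclic y : Set G) = Set.range φ := by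
    refine Set.Subset.antisymm ?_ ?_
    · exact procyclic_le (H := φ.range) (isCompact_range hφ).isClosed ⟨_, hφ1⟩
    · rintro _ ⟨x, rfl⟩
      exact hom_mem_of_apply_one_mem hφ (isClosed_procyclic y) (by rw [hφ1]; exact mem_procyclic y) x
  obtain ⟨t, ht, ψ, hψ, hψinj, hψo, hψφ⟩ := exists_injective_of_isOpen_range hφ (hrange ▸ hyo)
  refine ⟨t, ht, ψ, ?_, hψ, hψinj, hψo, fun x => hcen _ (hrange.ge (hψφ ⟨x, rfl⟩))⟩
  by_contra htn
  rw [Finset.not_nonempty_iff_eq_empty] at htn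
  have : IsEmpty t := by rw [htn]; infer_instance
  have hsub : Set.range ψ = {1} := by
    rw [Set.range_eq_singleton_iff]
    intro x
    rw [Subsingleton.elim x 1, map_one]
  rw [hsub] at hψo
  have := discreteTopology_of_isOpen_singleton_one hψo
  have : Finite G := finite_of_compact_of_discrete
  exact not_finite G

end

/-! ### Splitting off the torsion of an abelian group -/

theorem IsFiniteTimesDistinctPadics.exists_hom {A : Type*} [Group A] [TopologicalSpace A]
    (h : IsFiniteTimesDistinctPadics A) :
    ∃ (s : Finset ℕ) (_ : ∀ p : s, Fact (Nat.Prime p)) (φ : Multiplicative (PadicProd s) →* A),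
      s.Nonempty ∧ Continuous φ ∧ Function.Injective φ ∧ IsOpen (Set.range φ) := by
  obtain ⟨s, hs, F, iF, tF, hne, hfin, hdisc, ⟨e⟩⟩ := h
  let φ : Multiplicative (PadicProd s) →* A :=
    e.symm.toMonoidHom.comp (AddMonoidHom.toMultiplicative (AddMonoidHom.inr F (PadicProd s)))
  have hφ : ∀ x, φ (ofAdd x) = e.symm (ofAdd (0, x)) := fun _ => rfl
  refine ⟨s, hs, φ, hne, ?_, ?_, ?_⟩
  · exact e.symm.continuous.comp (continuous_ofAdd.comp
      ((continuous_const.prodMk continuous_id).comp continuous_toAdd))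
  · intro x y hxy
    exact (Prod.mk.inj (e.symm.injective hxy)).2
  · have h1 : IsOpen {x : A | (toAdd (e x)).1 = 0} :=
      (isOpen_discrete ({0} : Set F)).preimage
        (continuous_fst.comp (continuous_toAdd.comp e.continuous))
    convert h1 using 1
    ext x
    constructor
    · rintro ⟨y, rfl⟩
      obtain ⟨y, rfl⟩ := ofAdd.surjective y
      simp [hφ]
    · intro hx
      refine ⟨ofAdd (toAdd (e x)).2, ?_⟩
      rw [Set.mem_ofPred_eq] at hx
      rw [hφ, ← hx]
      exact e.symm_apply_apply x

/-- Let `B` be an open subgroup of `A` isomorphic to `∏ ℤ_[p]` and `m` its index. The elements of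
`B` that are `m`-th powers in `A` form an ideal of `∏ ℤ_[p]`, generated by some `d`, and `d` has an
`m`-th root `a` whose order modulo open subgroups involves only primes of `s`. The map `1 ↦ a`
then gives a copy of `∏ ℤ_[p]` that is a complement of the `m`-torsion of `A`. -/
theorem isFiniteTimesDistinctPadics_of_isOpen_range {A : Type*} [CommGroup A] [TopologicalSpace A]
    [IsTopologicalGroup A] [CompactSpace A] [TotallyDisconnectedSpace A] {s : Finset ℕ}
    [hs : ∀ p : s, Fact (Nat.Prime p)] (hne : s.Nonempty)
    {φ : Multiplicative (PadicProd s) →* A} (hφ : Continuous φ) (hinj : Function.Injective φ)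
    (ho : IsOpen (Set.range φ)) : IsFiniteTimesDistinctPadics A := by
  have hfin : Finite (A ⧸ φ.range) := Subgroup.quotient_finite_of_isOpen _ ho
  have hm : φ.range.index ≠ 0 := Subgroup.index_ne_zero_of_finite
  have hpow : ∀ g : A, ∃ x, φ x = g ^ φ.range.index := fun g => φ.range.pow_index_mem g
  generalize φ.range.index = m at hm hpow
  have hmtor : ∀ x : Multiplicative (PadicProd s), x ^ m = 1 → x = 1 := by
    intro x hx
    obtain ⟨x, rfl⟩ := ofAdd.surjective x
    rw [← ofAdd_nsmul, ofAdd_eq_one] at hx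
    rw [ofAdd_eq_one]
    funext p
    exact (smul_eq_zero.1 (congrFun hx p)).resolve_left hm
  -- the ideal of `m`-th powers and its generator `d`
  obtain ⟨I, hI⟩ := exists_ideals_comap hφ (H := (powMonoidHom m : A →* A).range)
    (isCompact_range (continuous_pow m)).isClosed
  have hIm : ∀ p, (m : ℤ_[(p : ℕ)]) ∈ I p := by
    intro p
    have h1 := (hI (ofAdd (m : PadicProd s))).1 ⟨φ (ofAdd 1), by
      rw [powMonoidHom_apply, ← map_pow, ← ofAdd_nsmul, nsmul_one]⟩ p
    rwa [toAdd_ofAdd, Pi.natCast_apply] at h1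
  have hspan : ∀ p, ∃ k : ℕ, I p = Ideal.span {((p : ℕ) : ℤ_[(p : ℕ)]) ^ k} := fun p =>
    PadicInt.ideal_eq_span_pow_p fun h => by
      have h1 := hIm p
      rw [h, Ideal.mem_bot] at h1
      exact hm (Nat.cast_eq_zero.1 h1)
  choose k hk using hspan
  let d : PadicProd s := fun p => ((p : ℕ) : ℤ_[(p : ℕ)]) ^ k p
  have hd : ∀ x : PadicProd s, (∃ a, a ^ m = φ (ofAdd x)) ↔ d ∣ x := by
    intro x
    refine (hI (ofAdd x)).trans ?_
    rw [pi_dvd_iff]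
    refine forall_congr' fun p => ?_
    rw [hk, Ideal.mem_span_singleton, toAdd_ofAdd]
  have hd0 : ∀ x : PadicProd s, d * x = 0 → x = 0 := by
    intro x hx
    funext p
    have h1 := congrFun hx p
    rw [Pi.mul_apply, Pi.zero_apply] at h1
    exact (mul_eq_zero.1 h1).resolve_left
      (pow_ne_zero _ (Nat.cast_ne_zero.2 (hs p).out.ne_zero))
  clear_value d
  -- an `m`-th root `a` of `d` whose order only involves primes of `s`
  obtain ⟨m', j, hco, e, he⟩ := Nat.exists_coprime_dvd_mul_pow hm (primeProd s)
  obtain ⟨u, hu⟩ : ∃ u : PadicProd s, (m' : PadicProd s) * u = 1 := by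
    have : IsUnit (m' : PadicProd s) := by
      rw [Pi.isUnit_iff]
      intro p
      exact PadicInt.isUnit_natCast_of_coprime
        (hco.coprime_dvd_right (Dvd.intro _ (primeProd_eq_mul p).symm))
    exact this.exists_right_inv
  obtain ⟨a₁, ha₁⟩ := (hd (d * u)).2 (dvd_mul_right _ _)
  have ha : (a₁ ^ m') ^ m = φ (ofAdd d) := by
    rw [← pow_mul, mul_comm, pow_mul, ha₁, ← map_pow, ← ofAdd_nsmul, nsmul_eq_mul, mul_left_comm,
      hu, mul_one]
  obtain ⟨σ, hσ, hσ1⟩ := exists_hom_apply_one_eq (s := s) (a₁ ^ m') (by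
    intro U hU
    obtain ⟨l, hl⟩ := exists_forall_primeProd_pow_dvd_mem (x := (0 : PadicProd s))
      (U := {x | φ (ofAdd x) ∈ U}) ((hU.preimage hφ).preimage continuous_ofAdd)
      (by simp [one_mem])
    refine ⟨j + l, ?_⟩
    rw [← pow_mul, pow_add, ← mul_assoc, he, pow_mul, pow_mul, ha₁, ← map_pow, ← map_pow,
      ← ofAdd_nsmul, ← ofAdd_nsmul]
    refine hl _ ?_
    rw [sub_zero, nsmul_eq_mul, Nat.cast_pow]
    exact dvd_mul_right _ _)
  have hσm : ∀ x : PadicProd s, σ (ofAdd x) ^ m = φ (ofAdd (d * x)) := by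
    intro x
    have h1 := hom_eq_of_apply_one_eq (f := (powMonoidHom m).comp σ)
      (g := φ.comp (AddMonoidHom.toMultiplicative (AddMonoidHom.mulLeft d)))
      ((continuous_pow m).comp hσ)
      (hφ.comp (continuous_ofAdd.comp ((continuous_const_mul d).comp continuous_toAdd)))
      (by
        change σ (ofAdd 1) ^ m = φ (ofAdd (d * 1))
        rw [hσ1, ha, mul_one])
    exact DFunLike.congr_fun h1 (ofAdd x)
  -- the `m`-torsion is finite
  let K : Subgroup A := (powMonoidHom m : A →* A).ker
  have hK : ∀ x, x ∈ K ↔ x ^ m = 1 := fun x => Iff.rfl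
  have hKfin : Finite K := by
    refine Finite.of_injective (fun x : K => (QuotientGroup.mk (x : A) : A ⧸ φ.range)) ?_
    intro x y hxy
    obtain ⟨b, hb⟩ := QuotientGroup.eq.1 hxy
    have h1 : φ (b ^ m) = 1 := by
      rw [map_pow, hb]
      exact K.mul_mem (K.inv_mem x.2) y.2
    rw [hmtor b (hinj (by rw [h1, map_one])), map_one] at hb
    exact Subtype.ext (inv_mul_eq_one.1 hb.symm)
  obtain ⟨F, iF, ⟨ε⟩⟩ : ∃ (F : Type) (_ : AddCommGroup F), Nonempty (F ≃+ Additive K) :=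
    ⟨Shrink.{0} (Additive K), inferInstance, ⟨Shrink.addEquiv⟩⟩
  let tF : TopologicalSpace F := ⊥
  have hF : DiscreteTopology F := ⟨rfl⟩
  have hFfin : Finite F := Finite.of_equiv _ ε.symm.toEquiv
  let θ : Multiplicative (F × PadicProd s) →* A :=
    { toFun := fun x => ((ε (toAdd x).1).toMul : A) * σ (ofAdd (toAdd x).2)
      map_one' := by simp
      map_mul' := fun x y => by
        simp only [toAdd_mul, Prod.fst_add, Prod.snd_add, map_add, toMul_add, ofAdd_add, map_mul,
          Subgroup.coe_mul]
        exact mul_mul_mul_comm _ _ _ _ }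
  have hθ : Continuous θ := by
    refine Continuous.mul ?_ ?_
    · exact (continuous_of_discreteTopology (f := fun x : F => ((ε x).toMul : A))).comp
        (continuous_fst.comp continuous_toAdd)
    · exact hσ.comp (continuous_ofAdd.comp (continuous_snd.comp continuous_toAdd))
  have hθinj : Function.Injective θ := by
    rw [injective_iff_map_eq_one]
    intro x hx
    obtain ⟨⟨f, c⟩, rfl⟩ := ofAdd.surjective x
    change ((ε f).toMul : A) * σ (ofAdd c) = 1 at hx
    have h1 : φ (ofAdd (d * c)) = 1 := by
      have h2 := congrArg (· ^ m) hx
      simp only [mul_pow, one_pow] at h2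
      rwa [(hK _).1 (ε f).toMul.2, one_mul, hσm] at h2
    have hc : c = 0 := hd0 c (ofAdd_eq_one.1 (hinj (h1.trans (map_one φ).symm)))
    subst hc
    rw [ofAdd_zero, map_one, mul_one] at hx
    have h3 : ε f = 0 := Additive.toMul.injective (Subtype.ext hx)
    rw [(map_eq_zero_iff ε ε.injective).1 h3]
    rfl
  have hθsurj : Function.Surjective θ := by
    intro x
    obtain ⟨c, hc⟩ := hpow x
    obtain ⟨c, rfl⟩ := ofAdd.surjective c
    obtain ⟨y, rfl⟩ := (hd c).1 ⟨x, hc.symm⟩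
    have hxK : x * (σ (ofAdd y))⁻¹ ∈ K := by
      rw [hK, mul_pow, inv_pow, hσm, hc, mul_inv_cancel]
    refine ⟨ofAdd (ε.symm (Additive.ofMul ⟨_, hxK⟩), y), ?_⟩
    change ((ε (ε.symm _)).toMul : A) * σ (ofAdd y) = x
    rw [AddEquiv.apply_symm_apply, toMul_ofMul, inv_mul_cancel_right]
  let E := MulEquiv.ofBijective θ ⟨hθinj, hθsurj⟩
  have hE : Continuous E.symm :=
    (Continuous.homeoOfEquivCompactToT2 (f := E.toEquiv) hθ).symm.continuous
  exact ⟨s, hs, F, iF, tF, hne, hFfin, hF, ⟨(ContinuousMulEquiv.mk E hθ hE).symm⟩⟩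

/-! ### Centre and derived subgroup -/

open scoped commutatorElement

/-- Schur's theorem: the commutator `⁅x, y⁆` depends only on `x` and `y` modulo the centre, so there
are finitely many commutators. -/
theorem finite_commutator_of_finite_quotient_center {G : Type*} [Group G]
    [Finite (G ⧸ Subgroup.center G)] : Finite (commutator G) := by
  have hout : ∀ x : G, ∃ z ∈ Subgroup.center G,
      x = (QuotientGroup.mk x : G ⧸ Subgroup.center G).out * z := by
    intro x
    obtain ⟨⟨z, hz⟩, hx⟩ := QuotientGroup.mk_out_eq_mul (Subgroup.center G) x
    exact ⟨z⁻¹, inv_mem hz, by rw [hx]; simp⟩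
  have hfin : (commutatorSet G).Finite := by
    refine (Set.finite_range fun q : (G ⧸ Subgroup.center G) × (G ⧸ Subgroup.center G) =>
      ⁅q.1.out, q.2.out⁆).subset ?_
    rintro _ ⟨x, y, rfl⟩
    refine ⟨(QuotientGroup.mk x, QuotientGroup.mk y), ?_⟩
    obtain ⟨z, hz, hx⟩ := hout x
    obtain ⟨w, hw, hy⟩ := hout y
    dsimp only
    generalize (QuotientGroup.mk x : G ⧸ Subgroup.center G).out = a at hx
    generalize (QuotientGroup.mk y : G ⧸ Subgroup.center G).out = b at hy
    rw [Subgroup.mem_center_iff] at hz hw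
    have h1 : ⁅x, y⁆ = ⁅a, y⁆ := by
      rw [hx, commutatorElement_def, commutatorElement_def, mul_assoc a z y, ← hz y]
      group
    have h2 : ⁅a, y⁆ = ⁅a, b⁆ := by
      rw [hy, commutatorElement_def, commutatorElement_def, ← mul_assoc a b w, mul_assoc _ w a⁻¹,
        ← hw a⁻¹]
      group
    rw [h1, h2]
  have := hfin.to_subtype
  infer_instance

theorem QuotientGroup.totallyDisconnectedSpace {G : Type*} [Group G] [TopologicalSpace G]
    [IsTopologicalGroup G] [CompactSpace G] [TotallyDisconnectedSpace G]
    (N : Subgroup G) [N.Normal] [hN : IsClosed (N : Set G)] :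
    TotallyDisconnectedSpace (G ⧸ N) := by
  have : TotallySeparatedSpace (G ⧸ N) := by
    refine totallySeparatedSpace_iff_exists_isClopen.2 fun x y hxy => ?_
    obtain ⟨x, rfl⟩ := QuotientGroup.mk_surjective x
    obtain ⟨y, rfl⟩ := QuotientGroup.mk_surjective y
    obtain ⟨M, -, hM, hMx⟩ := exists_openNormalSubgroup_le
      hN.isOpen_compl (x := y⁻¹ * x) (fun h => hxy (QuotientGroup.eq.2 h).symm)
    have hMc : IsClopen {g : G | x⁻¹ * g ∈ M} :=
      IsClopen.preimage ⟨M.isClosed_of_isOpen hM, hM⟩ (continuous_const_mul _)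
    refine ⟨QuotientGroup.mk '' {g : G | x⁻¹ * g ∈ M},
      ⟨(hMc.1.isCompact.image QuotientGroup.continuous_mk).isClosed,
        QuotientGroup.isOpenMap_coe _ hMc.2⟩, ⟨x, by simp [one_mem], rfl⟩, ?_⟩
    rintro ⟨g, hg, hgy⟩
    refine hMx _ hg ?_
    have h1 : y⁻¹ * g ∈ N := QuotientGroup.eq.1 hgy.symm
    simpa [mul_assoc] using h1
  infer_instance

theorem HasOpenCentralPadicProd.isOpen_center {G : Type*} [Group G]
    [TopologicalSpace G] [IsTopologicalGroup G] (h : HasOpenCentralPadicProd G) :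
    IsOpen (Subgroup.center G : Set G) := by
  obtain ⟨s, hs, φ, -, -, -, ho, hc⟩ := h
  exact Subgroup.isOpen_mono (H₁ := φ.range) (by rintro _ ⟨x, rfl⟩; exact hc x) ho

theorem HasOpenCentralPadicProd.finite_commutator {G : Type*} [Group G]
    [TopologicalSpace G] [IsTopologicalGroup G] [CompactSpace G] (h : HasOpenCentralPadicProd G) :
    Finite (commutator G) := by
  have : Finite (G ⧸ Subgroup.center G) := Subgroup.quotient_finite_of_isOpen _ h.isOpen_center
  exact finite_commutator_of_finite_quotient_center

section

variable {G : Type*} [Group G] [TopologicalSpace G] [IsTopologicalGroup G] [CompactSpace G]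
  [TotallyDisconnectedSpace G]

theorem hasOpenCentralPadicProd_iff_center :
    HasOpenCentralPadicProd G ↔
      IsOpen (Subgroup.center G : Set G) ∧ IsFiniteTimesDistinctPadics (Subgroup.center G) := by
  constructor
  · intro h
    have hZ := h.isOpen_center
    have : CompactSpace (Subgroup.center G) :=
      isCompact_iff_compactSpace.1 ((Subgroup.center G).isClosed_of_isOpen hZ).isCompact
    obtain ⟨s, hs, φ, hne, hφ, hinj, ho, hc⟩ := h
    let _ : CommGroup (Subgroup.center G) :=
      { (inferInstance : Group (Subgroup.center G)) with
        mul_comm := fun a b => Subtype.ext (Subgroup.mem_center_iff.1 b.2 a) }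
    have hinj' : Function.Injective (φ.codRestrict (Subgroup.center G) hc) :=
      fun x y hxy => hinj (congrArg Subtype.val hxy)
    refine ⟨hZ, isFiniteTimesDistinctPadics_of_isOpen_range (A := Subgroup.center G) hne
      (φ := φ.codRestrict (Subgroup.center G) hc) (hφ.subtype_mk hc) hinj' ?_⟩
    convert ho.preimage continuous_subtype_val using 1
    ext x
    simp [Subtype.ext_iff]
  · rintro ⟨hZ, h⟩
    obtain ⟨s, hs, φ, hne, hφ, hinj, ho⟩ := h.exists_hom
    refine ⟨s, hs, (Subgroup.center G).subtype.comp φ, hne, continuous_subtype_val.comp hφ,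
      Subtype.val_injective.comp hinj, ?_, fun x => (φ x).2⟩
    rw [MonoidHom.coe_comp, Set.range_comp]
    exact hZ.isOpenMap_subtype_val _ ho

theorem HasOpenCentralPadicProd.isFiniteTimesDistinctPadics_quotient_commutator
    (h : HasOpenCentralPadicProd G) : IsFiniteTimesDistinctPadics (G ⧸ commutator G) := by
  have hfin := h.finite_commutator
  have hcl : IsClosed (commutator G : Set G) := (Set.toFinite _).isClosed
  have := QuotientGroup.totallyDisconnectedSpace (commutator G)
  obtain ⟨s, hs, φ, hne, hφ, hinj, ho, hc⟩ := h
  let _ : CommGroup (G ⧸ commutator G) := inferInstanceAs (CommGroup (Abelianization G))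
  refine isFiniteTimesDistinctPadics_of_isOpen_range hne
    (φ := (QuotientGroup.mk' (commutator G)).comp φ) (QuotientGroup.continuous_mk.comp hφ) ?_ ?_
  · rw [injective_iff_map_eq_one]
    intro x hx
    have hx' : φ x ∈ commutator G := (QuotientGroup.eq_one_iff _).1 hx
    -- `φ x` has finite order, whereas `∏ ℤ_[p]` is torsion-free
    obtain ⟨n, hn, hxn⟩ := isOfFinOrder_iff_pow_eq_one.1 (isOfFinOrder_of_finite
      (⟨φ x, hx'⟩ : commutator G))
    have h1 : φ (x ^ n) = 1 := by
      rw [map_pow]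
      exact congrArg Subtype.val hxn
    have h2 : x ^ n = 1 := hinj (h1.trans (map_one φ).symm)
    obtain ⟨x, rfl⟩ := ofAdd.surjective x
    rw [← ofAdd_nsmul, ofAdd_eq_one] at h2
    rw [ofAdd_eq_one]
    funext p
    exact (smul_eq_zero.1 (congrFun h2 p)).resolve_left hn.ne'
  · rw [MonoidHom.coe_comp, Set.range_comp]
    exact QuotientGroup.isOpenMap_coe _ ho

/-- An open normal subgroup `U` that meets the finite group `G'` trivially is central and embeds in
`G ⧸ G'`. A large enough multiple of the given copy of `∏ ℤ_[p]` in `G ⧸ G'` lies in the image of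
`U`, so it lifts to `U`. -/
theorem hasOpenCentralPadicProd_of_commutator (hfin : (commutator G : Set G).Finite)
    (h : IsFiniteTimesDistinctPadics (G ⧸ commutator G)) : HasOpenCentralPadicProd G := by
  have hcl : IsClosed (commutator G : Set G) := hfin.isClosed
  obtain ⟨s, hs, φ, hne, hφ, hinj, ho⟩ := h.exists_hom
  let π : G →* G ⧸ commutator G := QuotientGroup.mk' _
  have hπ : Continuous π := QuotientGroup.continuous_mk
  have hπo : IsOpenMap π := QuotientGroup.isOpenMap_coe
  have hφo : IsOpenMap φ := MonoidHom.isOpenMap_of_isOpen_range hφ ho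
  obtain ⟨U, hUn, hU, hUG⟩ := exists_openNormalSubgroup_le
    (hfin.subset (Set.sdiff_subset (t := {1}))).isClosed.isOpen_compl (x := (1 : G)) (by simp)
  have hUG' : ∀ u ∈ U, u ∈ commutator G → u = 1 := by
    intro u hu hu'
    by_contra hu1
    exact hUG u hu (by rw [one_mul]; exact ⟨hu', hu1⟩)
  have hUinj : ∀ u ∈ U, ∀ v ∈ U, π u = π v → u = v := by
    intro u hu v hv huv
    exact inv_mul_eq_one.1 (hUG' _ (mul_mem (inv_mem hu) hv) (QuotientGroup.eq.1 huv))
  have hUc : ∀ u ∈ U, u ∈ Subgroup.center G := by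
    intro u hu
    rw [Subgroup.mem_center_iff]
    intro g
    refine commutatorElement_eq_one_iff_mul_comm.1 (hUG' _ ?_ ?_)
    · rw [commutatorElement_def]
      exact mul_mem (hUn.conj_mem u hu g) (inv_mem hu)
    · exact Subgroup.commutator_mem_commutator (Subgroup.mem_top g) (Subgroup.mem_top u)
  -- a multiple `q` of the generator that lifts to `U`
  obtain ⟨k, hk⟩ := exists_forall_primeProd_pow_dvd_mem (x := (0 : PadicProd s))
    (U := {x | φ (ofAdd x) ∈ π '' U}) (((hπo _ hU).preimage hφ).preimage continuous_ofAdd)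
    ⟨1, one_mem _, by simp⟩
  let q : PadicProd s := (primeProd s : PadicProd s) ^ k
  have hq : ∀ x : PadicProd s, q * x = 0 → x = 0 := by
    intro x hx
    funext p
    have h1 := congrFun hx p
    simp only [q, Pi.mul_apply, Pi.zero_apply, Pi.pow_apply, Pi.natCast_apply] at h1
    refine (mul_eq_zero.1 h1).resolve_left (pow_ne_zero _ (Nat.cast_ne_zero.2 ?_))
    exact Finset.prod_ne_zero_iff.2 fun p hp => (hs ⟨p, hp⟩).out.ne_zero
  obtain ⟨u, hu, huq⟩ := hk q (by rw [sub_zero])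
  obtain ⟨ψ, hψ, hψ1⟩ := exists_hom_apply_one_eq (s := s) u (by
    intro O hO
    obtain ⟨l, hl⟩ := exists_forall_primeProd_pow_dvd_mem (x := (0 : PadicProd s))
      (U := {x | φ (ofAdd x) ∈ π '' (O ∩ U)})
      (((hπo _ (hO.inter hU)).preimage hφ).preimage continuous_ofAdd)
      ⟨1, ⟨one_mem _, one_mem _⟩, by simp⟩
    obtain ⟨v, hv, hvl⟩ := hl ((primeProd s : PadicProd s) ^ l * q)
      (by rw [sub_zero]; exact dvd_mul_right _ _)
    refine ⟨l, ?_⟩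
    rw [hUinj (u ^ primeProd s ^ l) (pow_mem hu _) v hv.2]
    · exact hv.1
    · rw [map_pow, huq, hvl, ← map_pow, ← ofAdd_nsmul, nsmul_eq_mul, Nat.cast_pow])
  have hπψ : ∀ x : PadicProd s, π (ψ (ofAdd x)) = φ (ofAdd (q * x)) := by
    intro x
    have h1 := hom_eq_of_apply_one_eq (f := π.comp ψ)
      (g := φ.comp (AddMonoidHom.toMultiplicative (AddMonoidHom.mulLeft q)))
      (hπ.comp hψ)
      (hφ.comp (continuous_ofAdd.comp ((continuous_const_mul q).comp continuous_toAdd)))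
      (by
        change π (ψ (ofAdd 1)) = φ (ofAdd (q * 1))
        rw [hψ1, huq, mul_one])
    exact DFunLike.congr_fun h1 (ofAdd x)
  have hψU : ∀ x, ψ x ∈ U := fun x =>
    hom_mem_of_apply_one_mem hψ (U.isClosed_of_isOpen hU) (by rwa [hψ1]) x
  refine ⟨s, hs, ψ, hne, hψ, ?_, ?_, fun x => hUc _ (hψU x)⟩
  · rw [injective_iff_map_eq_one]
    intro x hx
    obtain ⟨x, rfl⟩ := ofAdd.surjective x
    have h1 := hπψ x
    rw [hx, map_one] at h1
    rw [ofAdd_eq_one]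
    exact hq x (ofAdd_eq_one.1 (hinj (h1.symm.trans (map_one φ).symm)))
  · -- the image of `ψ` consists of the elements of `U` lying over the image of `q`
    have h1 : IsOpen ((U : Set G) ∩ π ⁻¹' (φ '' (toAdd ⁻¹' {x | q ∣ x}))) :=
      hU.inter ((hφo _ ((isOpen_setOf_primeProd_pow_dvd k).preimage continuous_toAdd)).preimage hπ)
    convert h1 using 1
    ext g
    constructor
    · rintro ⟨x, rfl⟩
      obtain ⟨x, rfl⟩ := ofAdd.surjective x
      exact ⟨hψU _, ofAdd (q * x), dvd_mul_right _ _, (hπψ x).symm⟩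
    · rintro ⟨hg, x, hx, hxg⟩
      obtain ⟨x, rfl⟩ := ofAdd.surjective x
      obtain ⟨y, rfl⟩ : q ∣ x := hx
      exact ⟨ofAdd y, hUinj _ (hψU _) _ hg ((hπψ y).trans hxg)⟩

end

theorem theorem3p7 (G : Type*) [Group G] [TopologicalSpace G] [IsTopologicalGroup G]
    [CompactSpace G] [TotallyDisconnectedSpace G] [Infinite G] :
    List.TFAE [
      Cardinal.mk (ClosedSubgroup G) = Cardinal.aleph0,
      Cardinal.mk (ClosedSubgroup G) < 2 ^ Cardinal.aleph0,
      IsOpen (Subgroup.center G : Set G) ∧ IsFiniteTimesDistinctPadics (Subgroup.center G),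
      (commutator G : Set G).Finite ∧ IsFiniteTimesDistinctPadics (G ⧸ commutator G)] := by
  rw [← hasOpenCentralPadicProd_iff_center]
  tfae_have 1 → 2 := fun h => h ▸ Cardinal.cantor _
  tfae_have 2 → 3 := hasOpenCentralPadicProd_of_mk_closedSubgroup_lt
  tfae_have 3 → 1 := fun h =>
    have := h.countable_closedSubgroup
    have := infinite_closedSubgroup (G := G)
    Cardinal.mk_eq_aleph0 _
  tfae_have 3 → 4 := fun h =>
    have := h.finite_commutator
    ⟨Set.toFinite _, h.isFiniteTimesDistinctPadics_quotient_commutator⟩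
  tfae_have 4 → 3 := fun h => hasOpenCentralPadicProd_of_commutator h.1 h.2
  tfae_finish
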